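/- Let $d\in\mathbb N$. A *generator* is a random vector $Z=(Z_1,\dots,Z_d)\ge 0$ with $\mathbb E Z_i=1$ for all $i$; the simple max-stable law with generator $Z$ is the law on $\mathbb R^d$ with distribution function $G(x)=\exp(-\mathbb E\max_i (Z_i/x_i))$, $x\in(0,\infty)^d$. Its extremal coefficients and tail dependence coefficients are $$\theta(A)=\mathbb E\max_{i\in A}Z_i,\qquad \chi(A)=\mathbb E\min_{i\in A}Z_i,\qquad \emptyset\ne A\subset\{1,\dots,d\},$$ and $\theta(\emptyset)=0$. A simple max-stable law with extremal coefficients $\theta$ is a *Choquet* (Tawn–Molchanov) law if its distribution function is $$G(x)=\exp\bigl(-\ell^*(1/x_1,\dots,1/x_d)\bigr),\quad x\in(0,\infty)^d,\qquad \ell^*(y)=\int_0^\infty \theta(\{i: y_i\ge t\})\,dt .$$ For every extremal coefficient function $\theta$ (i.e. arising from some generator) there is exactly one Choquet law with extremal coefficients $\theta$, denoted $\mathrm{Choquet}_{\mathrm{EC}}(\theta)$; and for every tail dependence coefficient function $\chi$ (i.e. arising from some generator) there is exactly one Choquet law with tail dependence coefficients $\chi$, denoted $\mathrm{Choquet}_{\mathrm{TD}}(\chi)$.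 For laws $\mu,\nu$ on $\mathbb R^d$ write $\mu\le_{\mathrm{lo}}\nu$ if $\mu(\{x: x_i\le a_i\ \forall i\})\ge\nu(\{x: x_i\le a_i\ \forall i\})$ for all $a\in\mathbb R^d$, and $\mu\le_{\mathrm{uo}}\nu$ if $\mu(\{x: x_i> a_i\ \forall i\})\le\nu(\{x: x_i> a_i\ \forall i\})$ for all $a\in\mathbb R^d$. Then, for all extremal coefficient functions $\theta,\widetilde\theta$, $$\theta(A)\le\widetilde\theta(A)\ \text{ for all } A\neq\emptyset\iff \mathrm{Choquet}_{\mathrm{EC}}(\theta)\le_{\mathrm{lo}}\mathrm{Choquet}_{\mathrm{EC}}(\widetilde\theta),$$ and, for all tail dependence coefficient functions $\chi,\widetilde\chi$, $$\chi(A)\le\widetilde\chi(A)\ \text{ for all } A\neq\emptyset\iff \mathrm{Choquet}_{\mathrm{TD}}(\chi)\le_{\mathrm{uo}}\mathrm{Choquet}_{\mathrm{TD}}(\widetilde\chi).$$ -/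

import Mathlib

open MeasureTheory

noncomputable section

namespace MaxStable

variable {d : ℕ}

/-- The upper orthant `{x : x₁ > a₁, …, x_d > a_d}`. -/
def upperOrthant (a : Fin d → ℝ) : Set (Fin d → ℝ) := {x | ∀ i, a i < x i}

/-- The lower orthant `{x : x₁ ≤ a₁, …, x_d ≤ a_d}`. -/
def lowerOrthant (a : Fin d → ℝ) : Set (Fin d → ℝ) := {x | ∀ i, x i ≤ a i}

/-- Upper orthant order `μ ≤_uo ν` between laws on `ℝ^d`. -/
def UOLE (μ ν : Measure (Fin d → ℝ)) : Prop :=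
  ∀ a : Fin d → ℝ, μ (upperOrthant a) ≤ ν (upperOrthant a)

/-- Lower orthant order `μ ≤_lo ν` between laws on `ℝ^d` (note the reversed inequality). -/
def LOLE (μ ν : Measure (Fin d → ℝ)) : Prop :=
  ∀ a : Fin d → ℝ, ν (lowerOrthant a) ≤ μ (lowerOrthant a)

/-- `ρ` is the law of a generator: a random vector `Z ≥ 0` in `ℝ^d` with `E Z_i = 1` for all `i`. -/
structure IsGenerator (ρ : Measure (Fin d → ℝ)) : Prop where
  prob : IsProbabilityMeasure ρ
  nonneg : ∀ᵐ z ∂ρ, ∀ i, 0 ≤ z i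
  integrable : ∀ i, Integrable (fun z : Fin d → ℝ => z i) ρ
  mean_one : ∀ i, ∫ z, z i ∂ρ = 1

/-- `μ` is the simple max-stable law with generator `Z ∼ ρ`: its distribution function is
`G(x) = exp (-V(x))`, `V(x) = E max_i (Z_i / x_i)`, for `x ∈ (0,∞)^d`. -/
structure IsGeneratorOf (ρ μ : Measure (Fin d → ℝ)) : Prop where
  isGenerator : IsGenerator ρ
  law_prob : IsProbabilityMeasure μ
  cdf : ∀ x : Fin d → ℝ, (∀ i, 0 < x i) →
    μ (lowerOrthant x) = ENNReal.ofReal (Real.exp (-∫ z, (⨆ i, z i / x i) ∂ρ))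

/-- Extremal coefficients `θ(A) = E max_{i ∈ A} Z_i`; the maximum over `A = ∅` is `0`,
so that `θ(∅) = 0`. -/
def extremalCoeff (ρ : Measure (Fin d → ℝ)) (A : Finset (Fin d)) : ℝ :=
  ∫ z, (⨆ i : A, z i) ∂ρ

/-- Tail dependence coefficients `χ(A) = E min_{i ∈ A} Z_i` for `A ≠ ∅`
(the value at `A = ∅` is `0` and plays no role). -/
def tailDepCoeff (ρ : Measure (Fin d → ℝ)) (A : Finset (Fin d)) : ℝ :=
  ∫ z, (⨅ i : A, z i) ∂ρ

/-- `θ` is an extremal coefficient function. -/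
def IsExtremalCoeff (θ : Finset (Fin d) → ℝ) : Prop :=
  ∃ ρ : Measure (Fin d → ℝ), IsGenerator ρ ∧ θ = extremalCoeff ρ

/-- `χ` is a tail dependence coefficient function (with the convention `χ(∅) = 0`). -/
def IsTailDepCoeff (χ : Finset (Fin d) → ℝ) : Prop :=
  ∃ ρ : Measure (Fin d → ℝ), IsGenerator ρ ∧ χ = tailDepCoeff ρ

/-- The Choquet integral `ℓ*(x) = ∫₀^∞ θ({i : x_i ≥ t}) dt` with respect to `θ`. -/
def choquetIntegral (θ : Finset (Fin d) → ℝ) (x : Fin d → ℝ) : ℝ :=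
  ∫ t in Set.Ioi (0 : ℝ), θ (Finset.univ.filter fun i => t ≤ x i)

/-- The distribution function of `μ` on `(0,∞)^d` is `exp (-ℓ*(1/x₁, …, 1/x_d))`, where `ℓ*` is
the Choquet integral with respect to `θ`. -/
def HasChoquetCDF (θ : Finset (Fin d) → ℝ) (μ : Measure (Fin d → ℝ)) : Prop :=
  ∀ x : Fin d → ℝ, (∀ i, 0 < x i) →
    μ (lowerOrthant x) = ENNReal.ofReal (Real.exp (-choquetIntegral θ (fun i => 1 / x i)))

/-- `μ = Choquet_EC(θ)`: the law `μ` is simple max-stable with extremal coefficients `θ`, and its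
stable tail dependence function is the Choquet integral with respect to its extremal
coefficients. -/
def IsChoquetEC (θ : Finset (Fin d) → ℝ) (μ : Measure (Fin d → ℝ)) : Prop :=
  ∃ ρ : Measure (Fin d → ℝ), IsGeneratorOf ρ μ ∧ θ = extremalCoeff ρ ∧
    HasChoquetCDF (extremalCoeff ρ) μ

/-- `μ = Choquet_TD(χ)`: the law `μ` is simple max-stable with tail dependence coefficients `χ`,
and its stable tail dependence function is the Choquet integral with respect to its extremal
coefficients. -/
def IsChoquetTD (χ : Finset (Fin d) → ℝ) (μ : Measure (Fin d → ℝ)) : Prop :=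
  ∃ ρ : Measure (Fin d → ℝ), IsGeneratorOf ρ μ ∧ χ = tailDepCoeff ρ ∧
    HasChoquetCDF (extremalCoeff ρ) μ

end MaxStable

end

/-! Slicing a vector `z ≥ 0` into superlevel sets turns every generator into weights `w` on subsets:
`w C` is the expected length of the heights at which the superlevel set is `C`. Then `θ A` is the
`w`-mass of sets meeting `A` and `χ A` the mass of sets containing `A` (`extremalCoeff_eq`,
`tailDepCoeff_eq`). The Choquet integral of `θ` is the stable tail dependence function of the
discrete generator with weights `w`, so a Choquet law is the law of `max_{B ∋ i} w_B / E_B` with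
independent standard exponential `E_B` (`eq_choquetLaw`).

Lower orthants: the exponent of the distribution function is a nonnegative combination of the values
`θ C` (`tailFun_univ_eq_sum_layer`), hence monotone in `θ`; conversely, evaluating near the
indicator of `A` recovers `θ A`.

Upper orthants: by inclusion–exclusion the survival function is the probability that a Poisson
family of random sets covers a given set, and the superset sums of its intensity are `χ K` times a
minimum (`upSum_exceedanceWeight`). Covering probabilities increase with these superset sums
(`sum_neg_one_pow_exp_hitSum_le`): approximate the Poisson family by `n` independent sets and
replace them one at a time. Conversely, `χ A` is the derivative at `s = 0` of the probability that
all components in `A` exceed `1 / s`.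

Uniqueness follows from the two equivalences by antisymmetry of the orders. -/

noncomputable section

namespace MaxStable

/-! ### Inclusion–exclusion and unions of independent random sets. -/

section Combinatorics

variable {α : Type*} [Fintype α] [DecidableEq α]

/-- The mass that `p` gives to the sets meeting `A`. -/
def hitSum (p : Finset α → ℝ) (A : Finset α) : ℝ := ∑ C with ¬ Disjoint C A, p C

/-- The mass that `p` gives to the sets disjoint from `A`. -/
def avoidSum (p : Finset α → ℝ) (A : Finset α) : ℝ := ∑ C with Disjoint C A, p C

/-- The mass that `p` gives to the supersets of `A`. -/
def upSum (p : Finset α → ℝ) (A : Finset α) : ℝ := ∑ C with A ⊆ C, p C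

lemma avoidSum_add_hitSum (p : Finset α → ℝ) (A : Finset α) :
    avoidSum p A + hitSum p A = ∑ C, p C :=
  Finset.sum_filter_add_sum_filter_not _ _ _

lemma hitSum_empty (p : Finset α → ℝ) : hitSum p ∅ = 0 := by simp [hitSum]

/-- The subsets of `K` disjoint from `C` are the subsets of `K \ C`, and an alternating sum over a
powerset vanishes unless the set is empty. -/
lemma sum_powerset_disjoint_neg_one_pow_card {α : Type*} [DecidableEq α] (K C : Finset α) :
    ∑ A ∈ K.powerset, (if Disjoint C A then (-1 : ℝ) ^ A.card else 0) =
      if K ⊆ C then 1 else 0 := by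
  have h : K.powerset.filter (fun A => Disjoint C A) = (K \ C).powerset := by
    ext A
    simp only [Finset.mem_filter, Finset.mem_powerset, Finset.subset_sdiff, disjoint_comm]
  rw [← Finset.sum_filter, h]
  have := congrArg (Int.cast : ℤ → ℝ) (Finset.sum_powerset_neg_one_pow_card (x := K \ C))
  push_cast at this
  rw [this]
  simp [Finset.sdiff_eq_empty_iff_subset]

/-- Inclusion–exclusion: the superset sums are recovered from the avoidance sums. -/
lemma upSum_eq_sum_avoidSum (p : Finset α → ℝ) (K : Finset α) :
    upSum p K = ∑ A ∈ K.powerset, (-1) ^ A.card * avoidSum p A := by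
  simp only [upSum, avoidSum, Finset.sum_filter, Finset.mul_sum]
  rw [Finset.sum_comm]
  refine Finset.sum_congr rfl fun C _ => ?_
  have := congrArg (· * p C) (sum_powerset_disjoint_neg_one_pow_card K C)
  simp only [Finset.sum_mul, ite_mul, zero_mul, one_mul] at this
  rw [← this]
  refine Finset.sum_congr rfl fun A _ => ?_
  split_ifs <;> simp

/-- Avoidance is total mass minus hitting, and for nonempty `K` the constant total mass cancels in
the alternating sum. -/
lemma upSum_eq_neg_sum_hitSum (p : Finset α → ℝ) {K : Finset α} (hK : K.Nonempty) :
    upSum p K = ∑ A ∈ K.powerset, (-1) ^ A.card * -hitSum p A := by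
  have h0 : ∑ A ∈ K.powerset, (-1 : ℝ) ^ A.card = 0 := by
    have := congrArg (Int.cast : ℤ → ℝ) (Finset.sum_powerset_neg_one_pow_card_of_nonempty hK)
    exact_mod_cast this
  have h : ∀ A, avoidSum p A = ∑ C, p C + -hitSum p A := fun A => by
    rw [← avoidSum_add_hitSum p A]; ring
  rw [upSum_eq_sum_avoidSum]
  simp only [h, mul_add, Finset.sum_add_distrib, ← Finset.sum_mul, h0, zero_mul, zero_add]

/-- The convolution of weights on sets with respect to union. -/
def unionConv (p q : Finset α → ℝ) (E : Finset α) : ℝ :=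
  ∑ x : Finset α × Finset α with x.1 ∪ x.2 = E, p x.1 * q x.2

lemma unionConv_nonneg {p q : Finset α → ℝ} (hp : ∀ C, 0 ≤ p C) (hq : ∀ C, 0 ≤ q C)
    (E : Finset α) : 0 ≤ unionConv p q E :=
  Finset.sum_nonneg fun _ _ => mul_nonneg (hp _) (hq _)

lemma unionConv_comm (p q : Finset α → ℝ) : unionConv p q = unionConv q p := by
  ext E
  simp only [unionConv, Finset.sum_filter]
  rw [← (Equiv.prodComm (Finset α) (Finset α)).sum_comp]
  simp [Finset.union_comm, mul_comm]

lemma sum_unionConv (p q : Finset α → ℝ) (P : Finset α → Prop) [DecidablePred P] :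
    ∑ E with P E, unionConv p q E =
      ∑ C, ∑ D, if P (C ∪ D) then p C * q D else 0 := by
  simp only [unionConv, Finset.sum_filter]
  rw [← Fintype.sum_prod_type' (fun C D => if P (C ∪ D) then p C * q D else 0)]
  have : ∀ E : Finset α, (if P E then ∑ x : Finset α × Finset α,
      (if x.1 ∪ x.2 = E then p x.1 * q x.2 else 0) else 0) =
      ∑ x : Finset α × Finset α,
        if x.1 ∪ x.2 = E then (if P (x.1 ∪ x.2) then p x.1 * q x.2 else 0) else 0 := by
    intro E
    split_ifs with h
    · refine Finset.sum_congr rfl fun x _ => ?_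
      by_cases hx : x.1 ∪ x.2 = E <;> simp [hx, h]
    · refine (Finset.sum_eq_zero fun x _ => ?_).symm
      by_cases hx : x.1 ∪ x.2 = E <;> simp [hx, h]
  simp only [this]
  rw [Finset.sum_comm]
  simp

/-- A union avoids `A` exactly when both sets do, so `avoidSum` turns union convolution into a
product. -/
lemma avoidSum_unionConv (p q : Finset α → ℝ) (A : Finset α) :
    avoidSum (unionConv p q) A = avoidSum p A * avoidSum q A := by
  rw [avoidSum, sum_unionConv, avoidSum, avoidSum, Finset.sum_filter, Finset.sum_filter,
    Finset.sum_mul_sum]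
  refine Finset.sum_congr rfl fun C _ => Finset.sum_congr rfl fun D _ => ?_
  by_cases h1 : Disjoint C A <;> by_cases h2 : Disjoint D A <;>
    simp [Finset.disjoint_union_left, h1, h2]

/-- Fix the second set `D`: the union covers `K` iff the first set covers `K \ D`. For `q ≥ 0` this
is monotone in the superset sums of `p`. -/
lemma upSum_unionConv (p q : Finset α → ℝ) (K : Finset α) :
    upSum (unionConv p q) K = ∑ D, q D * upSum p (K \ D) := by
  rw [upSum, sum_unionConv, Finset.sum_comm]
  refine Finset.sum_congr rfl fun D _ => ?_
  rw [upSum, Finset.sum_filter, Finset.mul_sum]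
  refine Finset.sum_congr rfl fun C _ => ?_
  have : K ⊆ C ∪ D ↔ K \ D ⊆ C := by rw [sdiff_le_iff', Finset.sup_eq_union]
  by_cases h : K \ D ⊆ C <;> simp [this, h, mul_comm]

/-- The two factors are exchanged one at a time, each time with the other factor nonnegative. -/
lemma upSum_unionConv_mono {p p' q q' : Finset α → ℝ} (hq : ∀ C, 0 ≤ q C) (hp' : ∀ C, 0 ≤ p' C)
    (h : ∀ K, upSum p K ≤ upSum p' K) (h' : ∀ K, upSum q K ≤ upSum q' K) (K : Finset α) :
    upSum (unionConv p q) K ≤ upSum (unionConv p' q') K := by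
  calc upSum (unionConv p q) K ≤ upSum (unionConv p' q) K := by
        rw [upSum_unionConv, upSum_unionConv]
        exact Finset.sum_le_sum fun D _ => mul_le_mul_of_nonneg_left (h _) (hq D)
    _ ≤ upSum (unionConv p' q') K := by
        rw [unionConv_comm p' q, unionConv_comm p' q', upSum_unionConv, upSum_unionConv]
        exact Finset.sum_le_sum fun D _ => mul_le_mul_of_nonneg_left (h' _) (hp' D)

/-- Iterated union convolution. -/
def unionPow (p : Finset α → ℝ) : ℕ → Finset α → ℝ
  | 0 => fun C => if C = ∅ then 1 else 0
  | n + 1 => unionConv (unionPow p n) p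

lemma unionPow_nonneg {p : Finset α → ℝ} (hp : ∀ C, 0 ≤ p C) (n : ℕ) (C : Finset α) :
    0 ≤ unionPow p n C := by
  induction n generalizing C with
  | zero => simp only [unionPow]; split_ifs <;> norm_num
  | succ n ih => exact unionConv_nonneg ih hp C

lemma avoidSum_unionPow (p : Finset α → ℝ) (n : ℕ) (A : Finset α) :
    avoidSum (unionPow p n) A = avoidSum p A ^ n := by
  induction n with
  | zero => simp [unionPow, avoidSum, Finset.sum_filter, Finset.sum_ite_eq']
  | succ n ih => rw [unionPow, avoidSum_unionConv, ih, pow_succ]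

lemma upSum_unionPow_mono {p p' : Finset α → ℝ} (hp : ∀ C, 0 ≤ p C) (hp' : ∀ C, 0 ≤ p' C)
    (h : ∀ K, upSum p K ≤ upSum p' K) (n : ℕ) (K : Finset α) :
    upSum (unionPow p n) K ≤ upSum (unionPow p' n) K := by
  induction n generalizing K with
  | zero => exact le_rfl
  | succ n ih => exact upSum_unionConv_mono hp (unionPow_nonneg hp' n) ih h K

/-- The weights `l / n` on nonempty sets, completed to total mass one at the empty set. -/
def binomialWeight (l : Finset α → ℝ) (n : ℕ) (C : Finset α) : ℝ :=
  if C = ∅ then 1 - (∑ D with D ≠ ∅, l D) / n else l C / n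

lemma sum_binomialWeight (l : Finset α → ℝ) (n : ℕ) : ∑ C, binomialWeight l n C = 1 := by
  rw [← Finset.sum_filter_add_sum_filter_not _ (fun C : Finset α => C = ∅)]
  have h1 : ∑ C with C ≠ ∅, binomialWeight l n C = (∑ D with D ≠ ∅, l D) / n := by
    rw [Finset.sum_div]
    refine Finset.sum_congr rfl fun C hC => ?_
    rw [binomialWeight, if_neg (Finset.mem_filter.1 hC).2]
  rw [h1, Finset.sum_filter, Finset.sum_ite_eq' Finset.univ (∅ : Finset α)]
  simp [binomialWeight]

lemma hitSum_binomialWeight (l : Finset α → ℝ) (n : ℕ) (A : Finset α) :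
    hitSum (binomialWeight l n) A = hitSum l A / n := by
  rw [hitSum, hitSum, Finset.sum_div]
  refine Finset.sum_congr rfl fun C hC => ?_
  rw [binomialWeight, if_neg]
  rintro rfl
  simp at hC

lemma upSum_binomialWeight (l : Finset α → ℝ) (n : ℕ) {K : Finset α} (hK : K.Nonempty) :
    upSum (binomialWeight l n) K = upSum l K / n := by
  rw [upSum, upSum, Finset.sum_div]
  refine Finset.sum_congr rfl fun C hC => ?_
  rw [binomialWeight, if_neg]
  rintro rfl
  exact hK.ne_empty (Finset.subset_empty.1 (Finset.mem_filter.1 hC).2)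

lemma binomialWeight_nonneg {l : Finset α → ℝ} (hl : ∀ C, 0 ≤ l C) {n : ℕ}
    (hn : ∑ D with D ≠ ∅, l D ≤ n) (C : Finset α) : 0 ≤ binomialWeight l n C := by
  rw [binomialWeight]
  split_ifs
  · exact sub_nonneg.2 (div_le_one_of_le₀ hn n.cast_nonneg)
  · exact div_nonneg (hl C) n.cast_nonneg

/-- Poisson limit: the union of `n` independent sets avoids `A` with weight `(1 - hitSum l A / n) ^
n`, which tends to `exp (-hitSum l A)`. -/
lemma tendsto_upSum_unionPow_binomialWeight (l : Finset α → ℝ) (K : Finset α) :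
    Filter.Tendsto (fun n => upSum (unionPow (binomialWeight l n) n) K) Filter.atTop
      (nhds (∑ A ∈ K.powerset, (-1) ^ A.card * Real.exp (-hitSum l A))) := by
  have h : ∀ n A, avoidSum (unionPow (binomialWeight l n) n) A = (1 + -hitSum l A / n) ^ n := by
    intro n A
    have := avoidSum_add_hitSum (binomialWeight l n) A
    rw [sum_binomialWeight, hitSum_binomialWeight] at this
    rw [avoidSum_unionPow, neg_div, ← sub_eq_add_neg, ← this, add_sub_cancel_right]
  simp only [upSum_eq_sum_avoidSum, h]
  exact tendsto_finsetSum _ fun A _ => (Real.tendsto_one_add_div_pow_exp _).const_mul _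

/-- Union of a Poisson family of sets: the probability of covering `K` is monotone in the
superset sums of the intensity. -/
theorem sum_neg_one_pow_exp_hitSum_le {l l' : Finset α → ℝ} (hl : ∀ C, 0 ≤ l C)
    (hl' : ∀ C, 0 ≤ l' C) (h : ∀ K : Finset α, K.Nonempty → upSum l K ≤ upSum l' K)
    (K : Finset α) :
    ∑ A ∈ K.powerset, (-1) ^ A.card * Real.exp (-hitSum l A) ≤
      ∑ A ∈ K.powerset, (-1) ^ A.card * Real.exp (-hitSum l' A) := by
  refine le_of_tendsto_of_tendsto (tendsto_upSum_unionPow_binomialWeight l K)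
    (tendsto_upSum_unionPow_binomialWeight l' K) ?_
  -- Only for `n` beyond both total masses are the weights left at the empty set nonnegative.
  obtain ⟨N, hN⟩ := exists_nat_ge (max (∑ D with D ≠ ∅, l D) (∑ D with D ≠ ∅, l' D))
  filter_upwards [Filter.eventually_ge_atTop N] with n hn
  have hn' : (N : ℝ) ≤ n := by exact_mod_cast hn
  refine upSum_unionPow_mono
    (binomialWeight_nonneg hl (((le_max_left _ _).trans hN).trans hn'))
    (binomialWeight_nonneg hl' (((le_max_right _ _).trans hN).trans hn')) (fun L => ?_) n K
  -- At `∅` both superset sums are the total mass one, so the hypothesis is needed for nonempty sets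
  -- only.
  rcases L.eq_empty_or_nonempty with rfl | hL
  · simp [upSum, sum_binomialWeight]
  · rw [upSum_binomialWeight _ _ hL, upSum_binomialWeight _ _ hL]
    exact div_le_div_of_nonneg_right (h L hL) n.cast_nonneg

end Combinatorics

/-! ### Layer decomposition of a nonnegative vector. -/

variable {d : ℕ}

lemma le_iSup_finset_iff {ι : Type*} (A : Finset ι) (v : ι → ℝ) {t : ℝ} (ht : 0 < t) :
    t ≤ ⨆ i : A, v i ↔ ∃ i ∈ A, t ≤ v i := by
  constructor
  · intro h
    rcases isEmpty_or_nonempty A with hA | hA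
    · rw [Real.iSup_of_isEmpty] at h
      exact absurd h (not_le.2 ht)
    · obtain ⟨i, hi⟩ := exists_eq_ciSup_of_finite (f := fun i : A => v i)
      exact ⟨i, i.2, hi ▸ h⟩
  · rintro ⟨i, hi, h⟩
    exact h.trans (le_ciSup (f := fun i : A => v i) (Set.finite_range _).bddAbove ⟨i, hi⟩)

lemma le_iInf_finset_iff {ι : Type*} {A : Finset ι} (hA : A.Nonempty) (v : ι → ℝ) {t : ℝ} :
    t ≤ ⨅ i : A, v i ↔ ∀ i ∈ A, t ≤ v i := by
  have : Nonempty A := hA.to_subtype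
  rw [le_ciInf_iff (Set.finite_range _).bddBelow]
  simp

/-- The superlevel set of `z` at height `t`. -/
def level (z : Fin d → ℝ) (t : ℝ) : Finset (Fin d) := Finset.univ.filter fun i => t ≤ z i

/-- The length of the set of positive heights at which the superlevel set of `z` equals `C`. -/
def layer (C : Finset (Fin d)) (z : Fin d → ℝ) : ℝ :=
  volume.real {t : ℝ | 0 < t ∧ level z t = C}

lemma layer_nonneg (C : Finset (Fin d)) (z : Fin d → ℝ) : 0 ≤ layer C z := measureReal_nonneg

lemma measurableSet_level_eq (C : Finset (Fin d)) :
    MeasurableSet {p : (Fin d → ℝ) × ℝ | 0 < p.2 ∧ level p.1 p.2 = C} := by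
  have : {p : (Fin d → ℝ) × ℝ | 0 < p.2 ∧ level p.1 p.2 = C} =
      {p | 0 < p.2} ∩ ⋂ i, {p : (Fin d → ℝ) × ℝ | p.2 ≤ p.1 i ↔ i ∈ C} := by
    ext p
    simp [level, Finset.ext_iff]
  rw [this]
  refine (measurableSet_lt measurable_const measurable_snd).inter (MeasurableSet.iInter fun i => ?_)
  have hi : MeasurableSet {p : (Fin d → ℝ) × ℝ | p.2 ≤ p.1 i} :=
    measurableSet_le measurable_snd ((measurable_pi_apply i).comp measurable_fst)
  by_cases h : i ∈ C
  · simpa [h] using hi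
  · simpa [h] using measurableSet_lt ((measurable_pi_apply i).comp measurable_fst)
      (measurable_snd (α := Fin d → ℝ) (β := ℝ))

lemma measurable_layer (C : Finset (Fin d)) : Measurable (layer C) :=
  (measurable_measure_prodMk_left (measurableSet_level_eq C)).ennreal_toReal

/-- Excluding `∅` keeps the heights below the maximum of `z`, so all measures are finite and
`volume.real` is additive. At `∅` the set of heights has infinite length and `layer` takes the
default value `0`. -/
lemma sum_layer (z : Fin d → ℝ) (P : Finset (Fin d) → Prop) [DecidablePred P] (hP : ¬ P ∅) :
    ∑ C with P C, layer C z = volume.real {t : ℝ | 0 < t ∧ P (level z t)} := by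
  have h : {t : ℝ | 0 < t ∧ P (level z t)} =
      ⋃ C ∈ Finset.univ.filter P, {t : ℝ | 0 < t ∧ level z t = C} := by
    ext t
    simp
  have hfin : ∀ C ∈ Finset.univ.filter P, volume {t : ℝ | 0 < t ∧ level z t = C} ≠ ⊤ := by
    intro C hC
    refine ne_top_of_le_ne_top (b := volume (Set.Ioc (0 : ℝ) (⨆ i : (Finset.univ : Finset (Fin d)), z i)))
      (by simp) (measure_mono fun t ht => ⟨ht.1, (le_iSup_finset_iff _ _ ht.1).2 ?_⟩)
    have hne : C.Nonempty := by
      rw [Finset.nonempty_iff_ne_empty]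
      rintro rfl
      exact hP (Finset.mem_filter.1 hC).2
    obtain ⟨i, hi⟩ := hne
    rw [← ht.2, level, Finset.mem_filter] at hi
    exact ⟨i, hi⟩
  rw [h, measureReal_biUnion_finset _ _ hfin]
  · rfl
  · intro C _ D _ hCD
    refine Set.disjoint_left.2 fun t h1 h2 => hCD (h1.2.symm.trans h2.2)
  · exact fun C _ => measurable_prodMk_left (measurableSet_level_eq C)

/-- The superlevel set at height `t > 0` meets `A` iff `t` is at most the maximum over `A`. -/
lemma hitSum_layer {z : Fin d → ℝ} (hz : ∀ i, 0 ≤ z i) (A : Finset (Fin d)) :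
    hitSum (fun C => layer C z) A = ⨆ i : A, z i := by
  have h : {t : ℝ | 0 < t ∧ ¬ Disjoint (level z t) A} = Set.Ioc 0 (⨆ i : A, z i) := by
    ext t
    refine and_congr_right fun ht => ?_
    rw [le_iSup_finset_iff _ _ ht, Finset.not_disjoint_iff]
    simp [level, and_comm]
  rw [hitSum, sum_layer z (fun C => ¬ Disjoint C A) (by simp), h, Real.volume_real_Ioc_of_le, sub_zero]
  exact Real.iSup_nonneg fun i => hz i

lemma upSum_layer {z : Fin d → ℝ} (hz : ∀ i, 0 ≤ z i) {A : Finset (Fin d)} (hA : A.Nonempty) :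
    upSum (fun C => layer C z) A = ⨅ i : A, z i := by
  have h : {t : ℝ | 0 < t ∧ A ⊆ level z t} = Set.Ioc 0 (⨅ i : A, z i) := by
    ext t
    refine and_congr_right fun ht => ?_
    rw [le_iInf_finset_iff hA]
    simp [level, Finset.subset_iff]
  rw [upSum, sum_layer z (fun C => A ⊆ C) (by simpa using hA.ne_empty), h,
    Real.volume_real_Ioc_of_le, sub_zero]
  exact Real.iInf_nonneg fun i => hz i

lemma layer_le {z : Fin d → ℝ} (hz : ∀ i, 0 ≤ z i) {C : Finset (Fin d)} {i : Fin d} (hi : i ∈ C) :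
    layer C z ≤ z i := by
  have h := hitSum_layer hz {i}
  rw [ciSup_unique] at h
  refine le_trans ?_ h.le
  exact Finset.single_le_sum (f := fun C => layer C z) (fun C _ => layer_nonneg C z) (by simp [hi])

/-- Weights on sets that are the spectral weights of a simple max-stable law. -/
structure IsSpectral (w : Finset (Fin d) → ℝ) : Prop where
  nonneg : ∀ B, 0 ≤ w B
  hitSum_singleton : ∀ i, hitSum w {i} = 1

/-- The spectral weights associated with a generator. -/
def spectralWeight (ρ : Measure (Fin d → ℝ)) (C : Finset (Fin d)) : ℝ := ∫ z, layer C z ∂ρ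

/-! ### Coefficients of a generator as sums of spectral weights. -/

namespace IsGenerator

variable {ρ : Measure (Fin d → ℝ)}

lemma integrable_layer (h : IsGenerator ρ) {C : Finset (Fin d)} (hC : C.Nonempty) :
    Integrable (layer C) ρ := by
  obtain ⟨i, hi⟩ := hC
  refine (h.integrable i).mono' (measurable_layer C).aestronglyMeasurable ?_
  filter_upwards [h.nonneg] with z hz
  rw [Real.norm_of_nonneg (layer_nonneg C z)]
  exact layer_le hz hi

lemma extremalCoeff_eq (h : IsGenerator ρ) : extremalCoeff ρ = hitSum (spectralWeight ρ) := by
  ext A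
  simp only [hitSum, spectralWeight]
  rw [extremalCoeff, ← integral_finsetSum]
  · refine integral_congr_ae ?_
    filter_upwards [h.nonneg] with z hz
    exact (hitSum_layer hz A).symm
  · intro C hC
    refine h.integrable_layer (Finset.nonempty_iff_ne_empty.2 ?_)
    rintro rfl
    simp at hC

lemma tailDepCoeff_eq (h : IsGenerator ρ) {A : Finset (Fin d)} (hA : A.Nonempty) :
    tailDepCoeff ρ A = upSum (spectralWeight ρ) A := by
  simp only [upSum, spectralWeight]
  rw [tailDepCoeff, ← integral_finsetSum]
  · refine integral_congr_ae ?_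
    filter_upwards [h.nonneg] with z hz
    exact (upSum_layer hz hA).symm
  · intro C hC
    exact h.integrable_layer (hA.mono (Finset.mem_filter.1 hC).2)

lemma isSpectral (h : IsGenerator ρ) : IsSpectral (spectralWeight ρ) where
  nonneg C := integral_nonneg fun z => layer_nonneg C z
  hitSum_singleton i := by
    rw [← h.extremalCoeff_eq, extremalCoeff, ← h.mean_one i]
    simp only [ciSup_unique]
    rfl

end IsGenerator

lemma tailDepCoeff_empty (ρ : Measure (Fin d → ℝ)) : tailDepCoeff ρ ∅ = 0 := by
  simp [tailDepCoeff]

/-- The vector equal to `y` on `B` and to `0` elsewhere. -/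
def restrictTo (B : Finset (Fin d)) (y : Fin d → ℝ) (i : Fin d) : ℝ := if i ∈ B then y i else 0

lemma restrictTo_nonneg {y : Fin d → ℝ} (hy : ∀ i, 0 ≤ y i) (B : Finset (Fin d)) (i : Fin d) :
    0 ≤ restrictTo B y i := by
  rw [restrictTo]; split_ifs; exacts [hy i, le_rfl]

/-- The stable tail dependence function with spectral weights `w`, on the margin `A`. -/
def tailFun (w : Finset (Fin d) → ℝ) (y : Fin d → ℝ) (A : Finset (Fin d)) : ℝ :=
  ∑ B, w B * ⨆ i : A, restrictTo B y i

/-- For `t > 0`, `B` meets the superlevel set of `y` iff `t` is at most the maximum of `y` over `B`.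
Integrating over `t` replaces each indicator by that maximum. -/
lemma choquetIntegral_hitSum (w : Finset (Fin d) → ℝ) {y : Fin d → ℝ} (hy : ∀ i, 0 ≤ y i) :
    choquetIntegral (hitSum w) y = tailFun w y Finset.univ := by
  set s : Finset (Fin d) → ℝ := fun B => ⨆ i : (Finset.univ : Finset (Fin d)), restrictTo B y i
    with hs
  have h1 : ∀ t ∈ Set.Ioi (0 : ℝ), hitSum w (Finset.univ.filter fun i => t ≤ y i) =
      ∑ B, w B * (Set.Iic (s B)).indicator 1 t := by
    intro t ht
    rw [hitSum, Finset.sum_filter]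
    refine Finset.sum_congr rfl fun B _ => ?_
    have : ¬ Disjoint B (Finset.univ.filter fun i => t ≤ y i) ↔ t ≤ s B := by
      rw [hs, le_iSup_finset_iff _ _ ht, Finset.not_disjoint_iff]
      refine exists_congr fun i => ?_
      by_cases hi : i ∈ B <;> simp [restrictTo, hi, not_le.2 (Set.mem_Ioi.1 ht)]
    by_cases h : t ≤ s B <;> simp [this, h]
  have h2 : ∀ B, Set.Iic (s B) ∩ Set.Ioi 0 = Set.Ioc 0 (s B) := fun B => by
    ext t; simp [and_comm]
  have h3 : ∀ B, 0 ≤ s B := fun B => Real.iSup_nonneg fun i => restrictTo_nonneg hy B i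
  rw [choquetIntegral, setIntegral_congr_fun measurableSet_Ioi h1, integral_finsetSum]
  · refine Finset.sum_congr rfl fun B _ => ?_
    rw [integral_const_mul, integral_indicator_one measurableSet_Iic, measureReal_restrict_apply measurableSet_Iic, h2,
      Real.volume_real_Ioc_of_le (h3 B), sub_zero]
  · intro B _
    refine Integrable.const_mul ?_ _
    rw [integrable_indicator_iff measurableSet_Iic, IntegrableOn, Measure.restrict_restrict measurableSet_Iic, h2]
    exact integrableOn_const (by simp)

/-! ### Orthants determine laws. -/

section Orthants

lemma lowerOrthant_eq_pi (a : Fin d → ℝ) :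
    lowerOrthant a = Set.univ.pi fun i => Set.Iic (a i) := by
  ext x; simp [lowerOrthant, Pi.le_def]

lemma upperOrthant_eq_pi (a : Fin d → ℝ) :
    upperOrthant a = Set.univ.pi fun i => Set.Ioi (a i) := by
  ext x; simp [upperOrthant]

lemma measurableSet_upperOrthant (a : Fin d → ℝ) : MeasurableSet (upperOrthant a) := by
  rw [upperOrthant_eq_pi]
  exact MeasurableSet.univ_pi fun i => measurableSet_Ioi

/-- Two laws on `ℝ^d` that agree on the boxes built from a generating π-system of the line
agree. -/
lemma ext_of_pi_range {S : ℝ → Set ℝ} (hgen : borel ℝ = MeasurableSpace.generateFrom (Set.range S))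
    (hpi : IsPiSystem (Set.range S)) (hspan : IsCountablySpanning (Set.range S))
    {μ ν : Measure (Fin d → ℝ)} [IsProbabilityMeasure μ] [IsProbabilityMeasure ν]
    (h : ∀ a : Fin d → ℝ, μ (Set.univ.pi fun i => S (a i)) = ν (Set.univ.pi fun i => S (a i))) :
    μ = ν := by
  refine ext_of_generate_finite
    (Set.univ.pi '' Set.univ.pi fun _ : Fin d => Set.range S) ?_ (IsPiSystem.pi fun _ => hpi)
    ?_ (by simp)
  · refine (generateFrom_eq_pi (fun i => ?_) fun _ => hspan).symm
    rw [← hgen, BorelSpace.measurable_eq (α := ℝ)]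
  · rintro _ ⟨s, hs, rfl⟩
    choose a ha using fun i => hs i (Set.mem_univ i)
    have : s = fun i => S (a i) := funext fun i => (ha i).symm
    rw [this]
    exact h a

lemma ext_of_lowerOrthant {μ ν : Measure (Fin d → ℝ)} [IsProbabilityMeasure μ]
    [IsProbabilityMeasure ν] (h : ∀ a, μ (lowerOrthant a) = ν (lowerOrthant a)) : μ = ν := by
  refine ext_of_pi_range (borel_eq_generateFrom_Iic ℝ) isPiSystem_Iic
    ⟨fun n : ℕ => Set.Iic (n : ℝ), fun n => Set.mem_range_self _, ?_⟩ fun a => ?_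
  · rw [Set.iUnion_eq_univ_iff]
    exact fun x => (exists_nat_ge x).imp fun n hn => hn
  · rw [← lowerOrthant_eq_pi, h]

lemma ext_of_upperOrthant {μ ν : Measure (Fin d → ℝ)} [IsProbabilityMeasure μ]
    [IsProbabilityMeasure ν] (h : ∀ a, μ (upperOrthant a) = ν (upperOrthant a)) : μ = ν := by
  refine ext_of_pi_range (borel_eq_generateFrom_Ioi ℝ) isPiSystem_Ioi
    ⟨fun n : ℕ => Set.Ioi (-(n : ℝ)), fun n => Set.mem_range_self _, ?_⟩ fun a => ?_
  · rw [Set.iUnion_eq_univ_iff]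
    exact fun x => (exists_nat_gt (-x)).imp fun n hn => by simpa using neg_lt.1 hn
  · rw [← upperOrthant_eq_pi, h]

end Orthants

/-! ### The standard exponential law. -/

section ExponentialLaw

open ProbabilityTheory

instance : IsProbabilityMeasure (expMeasure 1) := isProbabilityMeasure_expMeasure one_pos

instance : NullSingletonClass (expMeasure 1) :=
  ⟨fun x => withDensity_absolutelyContinuous volume _ (measure_singleton x)⟩

lemma expMeasure_one_Iic {c : ℝ} (hc : 0 ≤ c) :
    (expMeasure 1).real (Set.Iic c) = 1 - Real.exp (-c) := by
  have h := cdf_expMeasure_eq one_pos c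
  rwa [cdf_eq_real, if_pos hc, one_mul] at h

lemma expMeasure_one_Ici {c : ℝ} (hc : 0 ≤ c) :
    expMeasure 1 (Set.Ici c) = ENNReal.ofReal (Real.exp (-c)) := by
  rw [← measure_congr Ioi_ae_eq_Ici, ← ofReal_measureReal, ← Set.compl_Iic,
    probReal_compl_eq_one_sub measurableSet_Iic, expMeasure_one_Iic hc, sub_sub_cancel]

lemma ae_pos_expMeasure_one : ∀ᵐ x ∂(expMeasure 1), 0 < x := by
  have h : (expMeasure 1).real (Set.Iic 0) = 0 := by simp [expMeasure_one_Iic le_rfl]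
  rw [ae_iff]
  simpa [← Set.Iic_def, measureReal_eq_zero_iff] using h

end ExponentialLaw

/-! ### The explicit max-stable law with given spectral weights. -/

lemma restrictTo_le_iSup (B : Finset (Fin d)) (y : Fin d → ℝ) {A : Finset (Fin d)} {i : Fin d}
    (hi : i ∈ A) : restrictTo B y i ≤ ⨆ i : A, restrictTo B y i :=
  le_ciSup (f := fun i : A => restrictTo B y i) (Set.finite_range _).bddAbove ⟨i, hi⟩

lemma iSup_restrictTo_le {B : Finset (Fin d)} {y : Fin d → ℝ} {A : Finset (Fin d)} {c : ℝ}
    (hc : 0 ≤ c) (h : ∀ i ∈ A, i ∈ B → y i ≤ c) : ⨆ i : A, restrictTo B y i ≤ c := by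
  refine Real.iSup_le (fun i => ?_) hc
  rw [restrictTo]
  split_ifs with hi
  exacts [h i i.2 hi, hc]

/-- The vector with components `max_{B ∋ i} w_B / E_B`. -/
def choquetVector (w : Finset (Fin d) → ℝ) (E : Finset (Fin d) → ℝ) (i : Fin d) : ℝ :=
  ⨆ B : Finset (Fin d), if i ∈ B then w B / E B else 0

/-- The max-stable law with discrete spectral weights `w`: the law of the vector with components
`max_{B ∋ i} w_B / E_B`, where the `E_B` are independent standard exponential variables. -/
def choquetLaw (w : Finset (Fin d) → ℝ) : Measure (Fin d → ℝ) :=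
  (Measure.pi fun _ : Finset (Fin d) => ProbabilityTheory.expMeasure 1).map (choquetVector w)

lemma measurable_choquetVector (w : Finset (Fin d) → ℝ) : Measurable (choquetVector w) := by
  refine measurable_pi_lambda _ fun i => Measurable.iSup fun B => ?_
  split_ifs
  · exact measurable_const.div (measurable_pi_apply B)
  · exact measurable_const

instance (w : Finset (Fin d) → ℝ) : IsProbabilityMeasure (choquetLaw w) :=
  Measure.isProbabilityMeasure_map (measurable_choquetVector w).aemeasurable

lemma ae_pos_pi_expMeasure : ∀ᵐ E ∂(Measure.pi fun _ : Finset (Fin d) =>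
    ProbabilityTheory.expMeasure 1), ∀ B, 0 < E B :=
  ae_all_iff.2 fun B => (Measure.tendsto_eval_ae_ae (i := B)).eventually ae_pos_expMeasure_one

lemma le_choquetVector (w E : Finset (Fin d) → ℝ) {B : Finset (Fin d)} {i : Fin d} (hi : i ∈ B) :
    w B / E B ≤ choquetVector w E i :=
  (if_pos hi).symm.le.trans
    (le_ciSup (f := fun B : Finset (Fin d) => if i ∈ B then w B / E B else 0)
      (Set.finite_range _).bddAbove B)

/-- Regrouping the inequalities `w B / E B ≤ a i` by `B` instead of `i` gives one threshold per `E
B`, so the event becomes a box of independent coordinates. -/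
lemma choquetVector_le_iff {w : Finset (Fin d) → ℝ} {E : Finset (Fin d) → ℝ}
    (hE : ∀ B, 0 < E B) {A : Finset (Fin d)} {a : Fin d → ℝ} (ha : ∀ i ∈ A, 0 < a i)
    (hw : ∀ B, 0 ≤ w B) :
    (∀ i ∈ A, choquetVector w E i ≤ a i) ↔
      ∀ B, w B * (⨆ i : A, restrictTo B (fun i => 1 / a i) i) ≤ E B := by
  have key : ∀ B, ∀ i ∈ A, w B / E B ≤ a i ↔ w B * (1 / a i) ≤ E B := fun B i hi => by
    rw [div_le_iff₀ (hE B), mul_one_div, div_le_iff₀ (ha i hi), mul_comm]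
  constructor
  · intro h B
    rw [Real.mul_iSup_of_nonneg (hw B)]
    refine Real.iSup_le (fun i => ?_) (hE B).le
    rw [restrictTo]
    split_ifs with hi
    · exact (key B i i.2).1 ((le_choquetVector w E hi).trans (h i i.2))
    · simpa using (hE B).le
  · intro h i hi
    refine Real.iSup_le (fun B => ?_) (ha i hi).le
    split_ifs with hB
    · refine (key B i hi).2 (le_trans (mul_le_mul_of_nonneg_left ?_ (hw B)) (h B))
      simpa [restrictTo, hB] using restrictTo_le_iSup B (fun i => 1 / a i) hi
    · exact (ha i hi).le

/-- The distribution functions of the margins of `choquetLaw w`. -/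
lemma choquetLaw_margin {w : Finset (Fin d) → ℝ} (hw : ∀ B, 0 ≤ w B) {A : Finset (Fin d)}
    {a : Fin d → ℝ} (ha : ∀ i ∈ A, 0 < a i) :
    choquetLaw w {x | ∀ i ∈ A, x i ≤ a i} =
      ENNReal.ofReal (Real.exp (-tailFun w (fun i => 1 / a i) A)) := by
  have hm : MeasurableSet {x : Fin d → ℝ | ∀ i ∈ A, x i ≤ a i} := by
    have : {x : Fin d → ℝ | ∀ i ∈ A, x i ≤ a i} = ⋂ i ∈ A, {x | x i ≤ a i} := by ext; simp
    rw [this]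
    exact A.measurableSet_biInter fun i _ => measurableSet_le (measurable_pi_apply i) measurable_const
  have hs : ∀ B, 0 ≤ w B * ⨆ i : A, restrictTo B (fun i => 1 / a i) i := fun B =>
    mul_nonneg (hw B) (Real.iSup_nonneg fun i => by
      rw [restrictTo]; split_ifs
      exacts [(one_div_pos.2 (ha i i.2)).le, le_rfl])
  rw [choquetLaw, Measure.map_apply (measurable_choquetVector w) hm]
  have : choquetVector w ⁻¹' {x | ∀ i ∈ A, x i ≤ a i} =ᵐ[Measure.pi fun _ : Finset (Fin d) =>
      ProbabilityTheory.expMeasure 1]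
      Set.univ.pi fun B => Set.Ici (w B * ⨆ i : A, restrictTo B (fun i => 1 / a i) i) := by
    refine Filter.eventuallyEq_set.2 ?_
    filter_upwards [ae_pos_pi_expMeasure] with E hE
    rw [Set.mem_univ_pi]
    exact choquetVector_le_iff (w := w) hE ha hw
  rw [measure_congr this, Measure.pi_pi, tailFun, ← Finset.sum_neg_distrib, Real.exp_sum,
    ENNReal.ofReal_prod_of_nonneg fun _ _ => (Real.exp_pos _).le]
  exact Finset.prod_congr rfl fun B _ => expMeasure_one_Ici (hs B)

lemma choquetLaw_lowerOrthant {w : Finset (Fin d) → ℝ} (hw : ∀ B, 0 ≤ w B)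
    {a : Fin d → ℝ} (ha : ∀ i, 0 < a i) :
    choquetLaw w (lowerOrthant a) =
      ENNReal.ofReal (Real.exp (-tailFun w (fun i => 1 / a i) Finset.univ)) := by
  rw [← choquetLaw_margin hw fun i _ => ha i]
  simp [lowerOrthant]

/-- The sets containing `i` have total weight one, so `y i` is the weighted sum of the `i`-th
entries whose maxima enter `tailFun`. -/
lemma IsSpectral.le_tailFun {w : Finset (Fin d) → ℝ} (hw : IsSpectral w) (y : Fin d → ℝ)
    {A : Finset (Fin d)} {i : Fin d} (hi : i ∈ A) : y i ≤ tailFun w y A := by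
  calc y i = hitSum w {i} * y i := by rw [hw.hitSum_singleton, one_mul]
    _ = ∑ B, w B * restrictTo B y i := by
        rw [hitSum, Finset.sum_mul, Finset.sum_filter]
        refine Finset.sum_congr rfl fun B _ => ?_
        by_cases h : i ∈ B <;> simp [restrictTo, h]
    _ ≤ tailFun w y A := Finset.sum_le_sum fun B _ =>
        mul_le_mul_of_nonneg_left (restrictTo_le_iSup B y hi) (hw.nonneg B)

/-- A law whose distribution function on `(0,∞)^d` is that of a simple max-stable law gives no
mass to lower orthants that are not in the positive range. -/
lemma lowerOrthant_eq_zero {w : Finset (Fin d) → ℝ} (hw : IsSpectral w)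
    {μ : Measure (Fin d → ℝ)} (h : ∀ a : Fin d → ℝ, (∀ i, 0 < a i) → μ (lowerOrthant a) =
      ENNReal.ofReal (Real.exp (-tailFun w (fun i => 1 / a i) Finset.univ)))
    {a : Fin d → ℝ} {i : Fin d} (hi : a i ≤ 0) : μ (lowerOrthant a) = 0 := by
  have hb : ∀ n : ℕ, μ (lowerOrthant a) ≤ ENNReal.ofReal (Real.exp (-((n : ℝ) + 1))) := by
    intro n
    have hn : (0 : ℝ) < 1 / ((n : ℝ) + 1) := by positivity
    -- Enlarge the orthant to one with positive corner. Its `i`-th entry is `1 / (n + 1)`, which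
    -- forces the exponent to be at least `n + 1`.
    have hpos : ∀ j, 0 < max (a j) (1 / ((n : ℝ) + 1)) := fun j => lt_max_of_lt_right hn
    refine (measure_mono fun x hx j => (hx j).trans (le_max_left _ _)).trans ((h _ hpos).le.trans ?_)
    refine ENNReal.ofReal_le_ofReal (Real.exp_le_exp.2 (neg_le_neg ?_))
    have := hw.le_tailFun (fun j => 1 / max (a j) (1 / ((n : ℝ) + 1))) (Finset.mem_univ i)
    rwa [max_eq_right (hi.trans hn.le), one_div_one_div] at this
  have ht : Filter.Tendsto (fun n : ℕ => ENNReal.ofReal (Real.exp (-((n : ℝ) + 1)))) Filter.atTop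
      (nhds 0) := by
    rw [← ENNReal.ofReal_zero]
    refine (ENNReal.continuous_ofReal.tendsto 0).comp (Real.tendsto_exp_neg_atTop_nhds_zero.comp ?_)
    exact Filter.tendsto_atTop_add_const_right _ _ tendsto_natCast_atTop_atTop
  exact le_antisymm (ge_of_tendsto' ht hb) zero_le

lemma eq_choquetLaw {w : Finset (Fin d) → ℝ} (hw : IsSpectral w)
    {μ : Measure (Fin d → ℝ)} [IsProbabilityMeasure μ]
    (h : ∀ a : Fin d → ℝ, (∀ i, 0 < a i) → μ (lowerOrthant a) =
      ENNReal.ofReal (Real.exp (-tailFun w (fun i => 1 / a i) Finset.univ))) :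
    μ = choquetLaw w := by
  refine ext_of_lowerOrthant fun a => ?_
  by_cases ha : ∀ i, 0 < a i
  · rw [h a ha, choquetLaw_lowerOrthant hw.nonneg ha]
  · push Not at ha
    obtain ⟨i, hi⟩ := ha
    rw [lowerOrthant_eq_zero hw h hi,
      lowerOrthant_eq_zero hw (fun a ha => choquetLaw_lowerOrthant hw.nonneg ha) hi]

/-- Unit mass at `{i}` provides some `B ∋ i` with `w B > 0`, hence a positive term in the maximum.
-/
lemma choquetLaw_ae_pos {w : Finset (Fin d) → ℝ} (hw : IsSpectral w) :
    ∀ᵐ x ∂(choquetLaw w), ∀ i, 0 < x i := by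
  have hm : MeasurableSet {x : Fin d → ℝ | ∀ i, 0 < x i} := by
    have := measurableSet_upperOrthant (0 : Fin d → ℝ)
    exact this
  rw [choquetLaw, ae_map_iff (measurable_choquetVector w).aemeasurable hm]
  filter_upwards [ae_pos_pi_expMeasure] with E hE i
  have hne : hitSum w {i} ≠ 0 := by rw [hw.hitSum_singleton]; exact one_ne_zero
  obtain ⟨B, hB, hwB⟩ := Finset.exists_ne_zero_of_sum_ne_zero hne
  have hiB : i ∈ B := by simpa using hB
  exact (div_pos ((hw.nonneg B).lt_of_ne' hwB) (hE B)).trans_le (le_choquetVector w E hiB)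

lemma iSup_restrictTo_const (A B : Finset (Fin d)) {c : ℝ} (hc : 0 ≤ c) :
    ⨆ i : A, restrictTo B (fun _ => c) i = if Disjoint B A then 0 else c := by
  split_ifs with h
  · exact le_antisymm (iSup_restrictTo_le le_rfl fun i hA hB => absurd hA (Finset.disjoint_left.1 h hB))
      (Real.iSup_nonneg fun i => restrictTo_nonneg (fun _ => hc) B i)
  · obtain ⟨i, hB, hA⟩ := Finset.not_disjoint_iff.1 h
    refine le_antisymm (iSup_restrictTo_le hc fun _ _ _ => le_rfl) ?_
    simpa [restrictTo, hB] using restrictTo_le_iSup B (fun _ => c) hA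

lemma iInf_restrictTo (A B : Finset (Fin d)) {y : Fin d → ℝ}
    (hy : ∀ i, 0 ≤ y i) :
    ⨅ i : A, restrictTo B y i = if A ⊆ B then ⨅ i : A, y i else 0 := by
  split_ifs with h
  · exact iInf_congr fun i => if_pos (h i.2)
  · obtain ⟨i, hiA, hiB⟩ := Finset.not_subset.1 h
    refine le_antisymm ?_ (Real.iInf_nonneg fun i => restrictTo_nonneg hy B i)
    have := ciInf_le (f := fun i : A => restrictTo B y i) (Set.finite_range _).bddBelow ⟨i, hiA⟩
    simpa [restrictTo, hiB] using this

lemma iSup_univ_finset (f : Fin d → ℝ) : ⨆ i : (Finset.univ : Finset (Fin d)), f i = ⨆ i, f i :=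
  (Equiv.subtypeUnivEquiv Finset.mem_univ).iSup_comp (g := f)

/-! ### A discrete generator with given spectral weights. -/

section DiscreteGenerator

/-- The weights `w`, with the weight of the empty set replaced by one. -/
def normWeight (w : Finset (Fin d) → ℝ) : Finset (Fin d) → ℝ := Function.update w ∅ 1

/-- The total mass of `normWeight w`. -/
def normMass (w : Finset (Fin d) → ℝ) : ℝ := ∑ B, normWeight w B

/-- The law of `m 1_S`, where the random set `S` takes the value `B` with probability `w_B / m`
for `B ≠ ∅`. -/
def discreteGen (w : Finset (Fin d) → ℝ) : Measure (Fin d → ℝ) :=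
  ∑ B, ENNReal.ofReal (normWeight w B / normMass w) •
    Measure.dirac (restrictTo B fun _ => normMass w)

variable {w : Finset (Fin d) → ℝ}

lemma normWeight_nonneg (hw : ∀ B, 0 ≤ w B) (B : Finset (Fin d)) : 0 ≤ normWeight w B := by
  rcases eq_or_ne B ∅ with rfl | h
  · simp [normWeight]
  · simpa [normWeight, h] using hw B

lemma normMass_pos (hw : ∀ B, 0 ≤ w B) : 0 < normMass w :=
  -- The weight one placed at `∅` keeps the mass positive even if all other weights vanish, as for
  -- `d = 0`.
  Finset.sum_pos' (fun B _ => normWeight_nonneg hw B) ⟨∅, Finset.mem_univ _, by simp [normWeight]⟩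

lemma isProbabilityMeasure_discreteGen (hw : ∀ B, 0 ≤ w B) :
    IsProbabilityMeasure (discreteGen w) := by
  constructor
  have h : ∀ B ∈ Finset.univ, 0 ≤ normWeight w B / normMass w := fun B _ =>
    div_nonneg (normWeight_nonneg hw B) (normMass_pos hw).le
  simp only [discreteGen, Measure.coe_finsetSum, Finset.sum_apply, Measure.smul_apply,
    measure_univ, smul_eq_mul, mul_one]
  rw [← ENNReal.ofReal_sum_of_nonneg h, ← Finset.sum_div, ← normMass,
    div_self (normMass_pos hw).ne', ENNReal.ofReal_one]

lemma integrable_discreteGen (f : (Fin d → ℝ) → ℝ) : Integrable f (discreteGen w) := by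
  refine integrable_finsetSum_measure.2 fun B _ => ?_
  exact (integrable_dirac (by simp)).smul_measure ENNReal.ofReal_ne_top

/-- The scale `normMass w` of the atoms cancels the normalisation of their probabilities; `g ∅ = 0`
makes the artificial weight at `∅` invisible. -/
lemma integral_discreteGen (hw : ∀ B, 0 ≤ w B) {f : (Fin d → ℝ) → ℝ} {g : Finset (Fin d) → ℝ}
    (hf : ∀ B, f (restrictTo B fun _ => normMass w) = normMass w * g B) (hg : g ∅ = 0) :
    ∫ z, f z ∂(discreteGen w) = ∑ B, w B * g B := by
  rw [discreteGen, integral_finsetSum_measure fun B _ =>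
    (integrable_dirac (by simp)).smul_measure ENNReal.ofReal_ne_top]
  refine Finset.sum_congr rfl fun B _ => ?_
  rw [integral_smul_measure, integral_dirac, hf, ENNReal.toReal_ofReal
    (div_nonneg (normWeight_nonneg hw B) (normMass_pos hw).le), smul_eq_mul, ← mul_assoc,
    div_mul_cancel₀ _ (normMass_pos hw).ne']
  rcases eq_or_ne B ∅ with rfl | h
  · simp [hg]
  · simp [normWeight, h]

lemma ae_nonneg_discreteGen (hw : ∀ B, 0 ≤ w B) : ∀ᵐ z ∂(discreteGen w), ∀ i, 0 ≤ z i := by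
  rw [ae_iff]
  simp only [discreteGen, Measure.coe_finsetSum, Finset.sum_apply, Measure.smul_apply]
  refine Finset.sum_eq_zero fun B _ => ?_
  refine (congrArg _ ?_).trans (smul_zero _)
  rw [← ae_iff, ae_dirac_eq]
  exact fun i => restrictTo_nonneg (fun _ => (normMass_pos hw).le) B i

lemma extremalCoeff_discreteGen (hw : ∀ B, 0 ≤ w B) :
    extremalCoeff (discreteGen w) = hitSum w := by
  ext A
  rw [extremalCoeff, integral_discreteGen hw (g := fun B => if ¬ Disjoint B A then 1 else 0)]
  · simp [hitSum, Finset.sum_filter]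
  · intro B
    rw [iSup_restrictTo_const A B (normMass_pos hw).le]
    split_ifs <;> simp
  · simp

lemma tailDepCoeff_discreteGen (hw : ∀ B, 0 ≤ w B) {A : Finset (Fin d)} (hA : A.Nonempty) :
    tailDepCoeff (discreteGen w) A = upSum w A := by
  rw [tailDepCoeff, integral_discreteGen hw (g := fun B => if A ⊆ B then 1 else 0)]
  · simp [upSum, Finset.sum_filter]
  · intro B
    have : Nonempty A := hA.to_subtype
    rw [iInf_restrictTo A B fun _ => (normMass_pos hw).le, ciInf_const]
    split_ifs <;> simp
  · simpa using hA.ne_empty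

lemma IsSpectral.isGenerator (hw : IsSpectral w) : IsGenerator (discreteGen w) where
  prob := isProbabilityMeasure_discreteGen hw.nonneg
  nonneg := ae_nonneg_discreteGen hw.nonneg
  integrable _ := integrable_discreteGen _
  mean_one i := by
    rw [← hw.hitSum_singleton i, ← extremalCoeff_discreteGen hw.nonneg, extremalCoeff]
    simp only [ciSup_unique]
    rfl

lemma integral_iSup_discreteGen (hw : ∀ B, 0 ≤ w B) (x : Fin d → ℝ) :
    ∫ z, (⨆ i, z i / x i) ∂(discreteGen w) =
      tailFun w (fun i => 1 / x i) Finset.univ := by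
  refine integral_discreteGen hw (fun B => ?_) ?_
  · rw [Real.mul_iSup_of_nonneg (normMass_pos hw).le,
      iSup_univ_finset fun i => normMass w * restrictTo B (fun i => 1 / x i) i]
    refine iSup_congr fun i => ?_
    simp only [restrictTo]
    split_ifs <;> simp [div_eq_mul_inv]
  · simp [restrictTo]

end DiscreteGenerator

/-! ### Choquet laws are exactly the explicit laws. -/

section Characterization

variable {w : Finset (Fin d) → ℝ}

lemma IsSpectral.isGeneratorOf (hw : IsSpectral w) :
    IsGeneratorOf (discreteGen w) (choquetLaw w) where
  isGenerator := hw.isGenerator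
  law_prob := inferInstance
  cdf x hx := by rw [choquetLaw_lowerOrthant hw.nonneg hx, integral_iSup_discreteGen hw.nonneg]

lemma choquetIntegral_one_div (w : Finset (Fin d) → ℝ) {x : Fin d → ℝ} (hx : ∀ i, 0 < x i) :
    choquetIntegral (hitSum w) (fun i => 1 / x i) = tailFun w (fun i => 1 / x i) Finset.univ :=
  choquetIntegral_hitSum w fun i => (one_div_pos.2 (hx i)).le

lemma IsSpectral.hasChoquetCDF (hw : IsSpectral w) :
    HasChoquetCDF (extremalCoeff (discreteGen w)) (choquetLaw w) := fun x hx => by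
  rw [choquetLaw_lowerOrthant hw.nonneg hx, extremalCoeff_discreteGen hw.nonneg,
    choquetIntegral_one_div w hx]

lemma IsSpectral.isChoquetEC (hw : IsSpectral w) : IsChoquetEC (hitSum w) (choquetLaw w) :=
  ⟨discreteGen w, hw.isGeneratorOf, (extremalCoeff_discreteGen hw.nonneg).symm, hw.hasChoquetCDF⟩

lemma IsSpectral.isChoquetTD (hw : IsSpectral w) :
    IsChoquetTD (tailDepCoeff (discreteGen w)) (choquetLaw w) :=
  ⟨discreteGen w, hw.isGeneratorOf, rfl, hw.hasChoquetCDF⟩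

lemma IsGeneratorOf.eq_choquetLaw {ρ μ : Measure (Fin d → ℝ)} (h : IsGeneratorOf ρ μ)
    (hμ : HasChoquetCDF (extremalCoeff ρ) μ) : μ = choquetLaw (spectralWeight ρ) := by
  have := h.law_prob
  refine MaxStable.eq_choquetLaw h.isGenerator.isSpectral fun a ha => ?_
  rw [hμ a ha, h.isGenerator.extremalCoeff_eq, choquetIntegral_one_div _ ha]

lemma IsChoquetEC.exists_isSpectral {θ : Finset (Fin d) → ℝ} {μ : Measure (Fin d → ℝ)}
    (h : IsChoquetEC θ μ) : ∃ w, IsSpectral w ∧ θ = hitSum w ∧ μ = choquetLaw w := by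
  obtain ⟨ρ, hρ, rfl, hμ⟩ := h
  exact ⟨spectralWeight ρ, hρ.isGenerator.isSpectral, hρ.isGenerator.extremalCoeff_eq,
    hρ.eq_choquetLaw hμ⟩

lemma IsChoquetTD.exists_isSpectral {χ : Finset (Fin d) → ℝ} {μ : Measure (Fin d → ℝ)}
    (h : IsChoquetTD χ μ) :
    ∃ w, IsSpectral w ∧ (∀ A : Finset (Fin d), A.Nonempty → χ A = upSum w A) ∧
      μ = choquetLaw w := by
  obtain ⟨ρ, hρ, rfl, hμ⟩ := h
  exact ⟨spectralWeight ρ, hρ.isGenerator.isSpectral,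
    fun A hA => hρ.isGenerator.tailDepCoeff_eq hA, hρ.eq_choquetLaw hμ⟩

lemma IsExtremalCoeff.exists_isChoquetEC {θ : Finset (Fin d) → ℝ} (h : IsExtremalCoeff θ) :
    ∃ μ, IsChoquetEC θ μ := by
  obtain ⟨ρ, hρ, rfl⟩ := h
  exact ⟨_, hρ.extremalCoeff_eq ▸ hρ.isSpectral.isChoquetEC⟩

lemma IsTailDepCoeff.exists_isChoquetTD {χ : Finset (Fin d) → ℝ} (h : IsTailDepCoeff χ) :
    ∃ μ, IsChoquetTD χ μ := by
  obtain ⟨ρ, hρ, rfl⟩ := h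
  have : tailDepCoeff ρ = tailDepCoeff (discreteGen (spectralWeight ρ)) := by
    ext A
    rcases A.eq_empty_or_nonempty with rfl | hA
    · rw [tailDepCoeff_empty, tailDepCoeff_empty]
    · rw [hρ.tailDepCoeff_eq hA, tailDepCoeff_discreteGen hρ.isSpectral.nonneg hA]
  exact ⟨_, this ▸ hρ.isSpectral.isChoquetTD⟩

end Characterization

/-! ### Lower orthant order and extremal coefficients. -/

section LowerOrthantOrder

lemma iSup_univ_restrictTo (B : Finset (Fin d)) {y : Fin d → ℝ} (hy : ∀ i, 0 ≤ y i) :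
    ⨆ i : (Finset.univ : Finset (Fin d)), restrictTo B y i = ⨆ i : B, y i := by
  refine le_antisymm (iSup_restrictTo_le (Real.iSup_nonneg fun i => hy i) fun i _ hB => ?_)
    (Real.iSup_le (fun i => ?_) (Real.iSup_nonneg fun i => restrictTo_nonneg hy B i))
  · exact le_ciSup (f := fun i : B => y i) (Set.finite_range _).bddAbove ⟨i, hB⟩
  · simpa [restrictTo] using restrictTo_le_iSup B y (Finset.mem_univ (i : Fin d))

/-- Slicing `y` into layers and exchanging the sums uses only that meeting is symmetric. The
coefficients `layer C y` are nonnegative, whence monotonicity in `hitSum w`. -/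
lemma tailFun_univ_eq_sum_layer (w : Finset (Fin d) → ℝ) {y : Fin d → ℝ} (hy : ∀ i, 0 ≤ y i) :
    tailFun w y Finset.univ = ∑ C, layer C y * hitSum w C := by
  simp only [tailFun, iSup_univ_restrictTo _ hy, ← hitSum_layer hy, hitSum, Finset.sum_filter,
    Finset.mul_sum]
  rw [Finset.sum_comm]
  refine Finset.sum_congr rfl fun C _ => Finset.sum_congr rfl fun B _ => ?_
  by_cases h : Disjoint B C
  · simp [h, h.symm]
  · simp [h, show ¬ Disjoint C B from fun h' => h h'.symm, mul_comm]

variable {w w' : Finset (Fin d) → ℝ}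

lemma LOLE_of_hitSum_le (hw : IsSpectral w) (hw' : IsSpectral w')
    (h : ∀ A : Finset (Fin d), A.Nonempty → hitSum w A ≤ hitSum w' A) :
    LOLE (choquetLaw w) (choquetLaw w') := by
  intro a
  by_cases ha : ∀ i, 0 < a i
  · have hy : ∀ i, 0 ≤ 1 / a i := fun i => (one_div_pos.2 (ha i)).le
    rw [choquetLaw_lowerOrthant hw.nonneg ha, choquetLaw_lowerOrthant hw'.nonneg ha,
      tailFun_univ_eq_sum_layer w hy, tailFun_univ_eq_sum_layer w' hy]
    refine ENNReal.ofReal_le_ofReal (Real.exp_le_exp.2 (neg_le_neg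
      (Finset.sum_le_sum fun C _ => mul_le_mul_of_nonneg_left ?_ (layer_nonneg C _))))
    rcases C.eq_empty_or_nonempty with rfl | hC
    · rw [hitSum_empty, hitSum_empty]
    · exact h C hC
  · push Not at ha
    obtain ⟨i, hi⟩ := ha
    rw [lowerOrthant_eq_zero hw' (fun a ha => choquetLaw_lowerOrthant hw'.nonneg ha) hi]
    exact zero_le

lemma hitSum_le_tailFun (hw : ∀ B, 0 ≤ w B) {y : Fin d → ℝ} (hy : ∀ i, 0 ≤ y i)
    {A : Finset (Fin d)} (hA : ∀ i ∈ A, 1 ≤ y i) : hitSum w A ≤ tailFun w y Finset.univ := by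
  rw [hitSum, tailFun, Finset.sum_filter]
  refine Finset.sum_le_sum fun B _ => ?_
  split_ifs with h
  · exact mul_nonneg (hw B) (Real.iSup_nonneg fun i => restrictTo_nonneg hy B i)
  · obtain ⟨i, hB, hiA⟩ := Finset.not_disjoint_iff.1 h
    refine le_mul_of_one_le_right (hw B) ((hA i hiA).trans ?_)
    simpa [restrictTo, hB] using restrictTo_le_iSup B y (Finset.mem_univ i)

lemma tailFun_le_hitSum_add (hw : ∀ B, 0 ≤ w B) {y : Fin d → ℝ} {s : ℝ} (hs : 0 ≤ s)
    {A : Finset (Fin d)} (h1 : ∀ i, y i ≤ 1) (hA : ∀ i ∉ A, y i ≤ s) :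
    tailFun w y Finset.univ ≤ hitSum w A + s * ∑ B, w B := by
  rw [hitSum, tailFun, Finset.sum_filter, Finset.mul_sum, ← Finset.sum_add_distrib]
  refine Finset.sum_le_sum fun B _ => ?_
  split_ifs with h
  · rw [zero_add, mul_comm s]
    exact mul_le_mul_of_nonneg_left
      (iSup_restrictTo_le hs fun i _ hB => hA i (Finset.disjoint_left.1 h hB)) (hw B)
  · refine (mul_le_of_le_one_right (hw B) (iSup_restrictTo_le zero_le_one fun i _ _ => h1 i)).trans ?_
    exact le_add_of_nonneg_right (mul_nonneg hs (hw B))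

lemma hitSum_le_of_LOLE (hw : IsSpectral w) (hw' : IsSpectral w')
    (h : LOLE (choquetLaw w) (choquetLaw w')) (A : Finset (Fin d)) :
    hitSum w A ≤ hitSum w' A := by
  have hs : ∀ n : ℕ, hitSum w A ≤ hitSum w' A + 1 / ((n : ℝ) + 1) * ∑ B, w' B := by
    intro n
    have hn : (0 : ℝ) < 1 / ((n : ℝ) + 1) := by positivity
    have hn1 : 1 / ((n : ℝ) + 1) ≤ 1 := by
      rw [div_le_one (by positivity)]
      exact le_add_of_nonneg_left n.cast_nonneg
    -- The indicator of `A` would isolate `hitSum w A`, but orthant corners must be finite and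
    -- positive; the value `1 / (n + 1)` off `A` costs an error that vanishes in the limit.
    set y : Fin d → ℝ := fun i => if i ∈ A then 1 else 1 / ((n : ℝ) + 1) with hy
    have hpos : ∀ i, 0 < y i := fun i => by
      simp only [hy]; split_ifs; exacts [one_pos, hn]
    have key := h fun i => 1 / y i
    rw [choquetLaw_lowerOrthant hw.nonneg fun i => one_div_pos.2 (hpos i),
      choquetLaw_lowerOrthant hw'.nonneg fun i => one_div_pos.2 (hpos i),
      ENNReal.ofReal_le_ofReal_iff (Real.exp_pos _).le, Real.exp_le_exp, neg_le_neg_iff] at key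
    simp only [one_div_one_div] at key
    refine (hitSum_le_tailFun hw.nonneg (fun i => (hpos i).le) fun i hi => ?_).trans (key.trans
      (tailFun_le_hitSum_add hw'.nonneg hn.le (fun i => ?_) fun i hi => ?_))
    · simp [hy, hi]
    · simp only [hy]; split_ifs; exacts [le_rfl, hn1]
    · simp [hy, hi]
  have hlim := ((tendsto_one_div_add_atTop_nhds_zero_nat (𝕜 := ℝ)).mul_const
    (∑ B, w' B)).const_add (hitSum w' A)
  rw [zero_mul, add_zero] at hlim
  exact ge_of_tendsto' hlim hs

end LowerOrthantOrder

/-! ### Upper orthant order and tail dependence coefficients. -/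

section UpperOrthantOrder

lemma tailFun_congr (w : Finset (Fin d) → ℝ) {y y' : Fin d → ℝ} {S : Finset (Fin d)}
    (h : ∀ i ∈ S, y i = y' i) : tailFun w y S = tailFun w y' S := by
  refine Finset.sum_congr rfl fun B _ => congrArg (w B * ·) (iSup_congr fun i => ?_)
  simp only [restrictTo, h i i.2]

/-- The weights of the sets of components in which a point of the exponent measure exceeds
`1 / y`. -/
def exceedanceWeight (w : Finset (Fin d) → ℝ) (y : Fin d → ℝ) (C : Finset (Fin d)) : ℝ :=
  ∑ B, w B * layer C (restrictTo B y)

variable {w w' : Finset (Fin d) → ℝ}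

lemma exceedanceWeight_nonneg (hw : ∀ B, 0 ≤ w B) (y : Fin d → ℝ) (C : Finset (Fin d)) :
    0 ≤ exceedanceWeight w y C :=
  Finset.sum_nonneg fun B _ => mul_nonneg (hw B) (layer_nonneg _ _)

lemma hitSum_exceedanceWeight (w : Finset (Fin d) → ℝ) {y : Fin d → ℝ} (hy : ∀ i, 0 ≤ y i)
    (S : Finset (Fin d)) : hitSum (exceedanceWeight w y) S = tailFun w y S := by
  simp only [tailFun, ← hitSum_layer (restrictTo_nonneg hy _), hitSum, exceedanceWeight,
    Finset.mul_sum]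
  exact Finset.sum_comm

/-- The minimum over `K` of `y` restricted to `B` is zero unless `K ⊆ B`, so the factor depending on
`y` separates. An inequality between superset sums of `w` and `w'` therefore passes to the
intensities for every `y ≥ 0`. -/
lemma upSum_exceedanceWeight (w : Finset (Fin d) → ℝ) {y : Fin d → ℝ} (hy : ∀ i, 0 ≤ y i)
    {K : Finset (Fin d)} (hK : K.Nonempty) :
    upSum (exceedanceWeight w y) K = upSum w K * ⨅ i : K, y i := by
  have h : upSum (exceedanceWeight w y) K =
      ∑ B, w B * upSum (fun C => layer C (restrictTo B y)) K := by
    simp only [upSum, exceedanceWeight, Finset.mul_sum]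
    exact Finset.sum_comm
  rw [h, upSum, Finset.sum_mul, Finset.sum_filter]
  refine Finset.sum_congr rfl fun B _ => ?_
  rw [upSum_layer (restrictTo_nonneg hy B) hK, iInf_restrictTo K B hy]
  split_ifs <;> simp

/-- The survival function of `choquetLaw w`. -/
lemma choquetLaw_upperOrthant (hw : IsSpectral w) (a : Fin d → ℝ) {A : Finset (Fin d)}
    (hA : ∀ i, i ∈ A ↔ 0 < a i) :
    (choquetLaw w).real (upperOrthant a) = ∑ S ∈ A.powerset,
      (-1) ^ S.card * Real.exp (-tailFun w (restrictTo A fun i => 1 / a i) S) := by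
  have hS : ∀ S ∈ A.powerset, (choquetLaw w).real (⋂ i ∈ S, {x | x i ≤ a i}) =
      Real.exp (-tailFun w (restrictTo A fun i => 1 / a i) S) := by
    intro S hS
    rw [Finset.mem_powerset] at hS
    have h1 : (⋂ i ∈ S, {x : Fin d → ℝ | x i ≤ a i}) = {x | ∀ i ∈ S, x i ≤ a i} := by ext; simp
    rw [h1, measureReal_def, choquetLaw_margin hw.nonneg fun i hi => (hA i).1 (hS hi),
      ENNReal.toReal_ofReal (Real.exp_pos _).le]
    congr 2
    exact tailFun_congr w fun i hi => by simp [restrictTo, hS hi]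
  have hmeas : ∀ i ∈ A, MeasurableSet {x : Fin d → ℝ | x i ≤ a i} := fun i _ =>
    measurableSet_le (measurable_pi_apply i) measurable_const
  -- The law lives on positive vectors, so constraints with `a i ≤ 0` hold almost surely and only
  -- indices in `A` matter.
  have hae : upperOrthant a =ᵐ[choquetLaw w] ((⋃ i ∈ A, {x | x i ≤ a i})ᶜ : Set (Fin d → ℝ)) := by
    refine Filter.eventuallyEq_set.2 ?_
    filter_upwards [choquetLaw_ae_pos hw] with x hx
    simp only [upperOrthant, Set.mem_ofPred_eq, Set.mem_compl_iff, Set.mem_iUnion, exists_prop,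
      not_exists, not_and, not_le, hA]
    exact ⟨fun h i _ => h i, fun h i => (lt_or_ge 0 (a i)).elim (h i) fun h0 => h0.trans_lt (hx i)⟩
  rw [measureReal_congr hae, probReal_compl_eq_one_sub (A.measurableSet_biUnion hmeas),
    measureReal_biUnion_eq_sum_powerset hmeas,
    ← Finset.sum_filter_add_sum_filter_not A.powerset Finset.Nonempty]
  have hempty : A.powerset.filter (fun S => ¬ S.Nonempty) = {∅} := by
    ext S
    simp only [Finset.mem_filter, Finset.mem_powerset, Finset.not_nonempty_iff_eq_empty,
      Finset.mem_singleton, and_iff_right_iff_imp]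
    rintro rfl
    exact Finset.empty_subset A
  rw [hempty, Finset.sum_singleton, sub_eq_neg_add, ← Finset.sum_neg_distrib]
  congr 1
  · refine Finset.sum_congr rfl fun S hS' => ?_
    rw [hS S (Finset.mem_filter.1 hS').1, pow_succ]
    ring
  · simp [tailFun]

lemma UOLE_of_upSum_le (hw : IsSpectral w) (hw' : IsSpectral w')
    (h : ∀ A : Finset (Fin d), A.Nonempty → upSum w A ≤ upSum w' A) :
    UOLE (choquetLaw w) (choquetLaw w') := by
  intro a
  set A : Finset (Fin d) := Finset.univ.filter fun i => 0 < a i with hA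
  have hmem : ∀ i, i ∈ A ↔ 0 < a i := fun i => by simp [hA]
  set y : Fin d → ℝ := restrictTo A fun i => 1 / a i with hy
  have hy0 : ∀ i, 0 ≤ y i := fun i => by
    rw [hy, restrictTo]
    split_ifs with hi
    exacts [(one_div_pos.2 ((hmem i).1 hi)).le, le_rfl]
  have hreal : (choquetLaw w).real (upperOrthant a) ≤ (choquetLaw w').real (upperOrthant a) := by
    rw [choquetLaw_upperOrthant hw a hmem, choquetLaw_upperOrthant hw' a hmem]
    simp only [← hy, ← hitSum_exceedanceWeight _ hy0]
    refine sum_neg_one_pow_exp_hitSum_le (exceedanceWeight_nonneg hw.nonneg y)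
      (exceedanceWeight_nonneg hw'.nonneg y) (fun K hK => ?_) A
    rw [upSum_exceedanceWeight w hy0 hK, upSum_exceedanceWeight w' hy0 hK]
    exact mul_le_mul_of_nonneg_right (h K hK) (Real.iInf_nonneg fun i => hy0 i)
  rw [← ofReal_measureReal, ← ofReal_measureReal (μ := choquetLaw w')]
  exact ENNReal.ofReal_le_ofReal hreal

lemma tailFun_const (w : Finset (Fin d) → ℝ) {s : ℝ} (hs : 0 ≤ s) (S : Finset (Fin d)) :
    tailFun w (fun _ => s) S = s * hitSum w S := by
  rw [tailFun, hitSum, Finset.sum_filter, Finset.mul_sum]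
  refine Finset.sum_congr rfl fun B _ => ?_
  rw [iSup_restrictTo_const S B hs]
  split_ifs <;> simp [mul_comm]

/-- The probability that all components in `A` exceed the level `1 / s`. -/
def jointSurvival (w : Finset (Fin d) → ℝ) (A : Finset (Fin d)) (s : ℝ) : ℝ :=
  ∑ S ∈ A.powerset, (-1) ^ S.card * Real.exp (-(s * hitSum w S))

/-- The level `0` off `A` imposes no condition almost surely. -/
lemma jointSurvival_eq (hw : IsSpectral w) (A : Finset (Fin d)) {s : ℝ} (hs : 0 < s) :
    (choquetLaw w).real (upperOrthant fun i => if i ∈ A then 1 / s else 0) =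
      jointSurvival w A s := by
  have hA : ∀ i, i ∈ A ↔ 0 < (if i ∈ A then 1 / s else 0) := fun i => by
    by_cases hi : i ∈ A <;> simp [hi, hs]
  rw [choquetLaw_upperOrthant hw _ hA]
  refine Finset.sum_congr rfl fun S hS => ?_
  rw [← tailFun_const w hs.le]
  congr 3
  refine tailFun_congr w fun i hi => ?_
  simp [restrictTo, Finset.mem_powerset.1 hS hi]

/-- Each exponential has derivative `-hitSum w S` at `0`, and inclusion–exclusion sums these to
`upSum w A`. -/
lemma hasDerivAt_jointSurvival (w : Finset (Fin d) → ℝ) {A : Finset (Fin d)} (hA : A.Nonempty) :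
    HasDerivAt (jointSurvival w A) (upSum w A) 0 := by
  rw [upSum_eq_neg_sum_hitSum w hA]
  refine HasDerivAt.fun_sum fun S _ => HasDerivAt.const_mul _ ?_
  have := (((hasDerivAt_id (0 : ℝ)).mul_const (hitSum w S)).neg).exp
  simpa using this

lemma upSum_le_of_UOLE (hw : IsSpectral w) (hw' : IsSpectral w')
    (h : UOLE (choquetLaw w) (choquetLaw w')) {A : Finset (Fin d)} (hA : A.Nonempty) :
    upSum w A ≤ upSum w' A := by
  have hle : ∀ s : ℝ, 0 < s → jointSurvival w A s ≤ jointSurvival w' A s := fun s hs => by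
    rw [← jointSurvival_eq hw A hs, ← jointSurvival_eq hw' A hs]
    exact ENNReal.toReal_mono (measure_ne_top _ _) (h _)
  have hd := ((hasDerivAt_jointSurvival w' hA).sub (hasDerivAt_jointSurvival w hA)).hasDerivWithinAt
    (s := Set.Ioi 0)
  rw [hasDerivWithinAt_iff_tendsto_slope' (by simp)] at hd
  refine sub_nonneg.1 (ge_of_tendsto hd ?_)
  filter_upwards [self_mem_nhdsWithin] with s hs
  -- At `s = 0` every exponential is one, so the difference starts at zero and its right slopes are
  -- nonnegative.
  have h0 : jointSurvival w' A 0 = jointSurvival w A 0 := by simp [jointSurvival]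
  rw [slope_def_field]
  simp only [Pi.sub_apply, h0, sub_self, sub_zero]
  exact div_nonneg (sub_nonneg.2 (hle s hs)) (Set.mem_Ioi.1 hs).le

end UpperOrthantOrder

/-! ### The order equivalences and uniqueness. -/

section Choquet

theorem IsChoquetEC.le_iff_LOLE {θ θ' : Finset (Fin d) → ℝ} {μ μ' : Measure (Fin d → ℝ)}
    (h : IsChoquetEC θ μ) (h' : IsChoquetEC θ' μ') :
    (∀ A : Finset (Fin d), A.Nonempty → θ A ≤ θ' A) ↔ LOLE μ μ' := by
  obtain ⟨w, hw, rfl, rfl⟩ := h.exists_isSpectral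
  obtain ⟨w', hw', rfl, rfl⟩ := h'.exists_isSpectral
  exact ⟨LOLE_of_hitSum_le hw hw', fun h A _ => hitSum_le_of_LOLE hw hw' h A⟩

theorem IsChoquetTD.le_iff_UOLE {χ χ' : Finset (Fin d) → ℝ} {μ μ' : Measure (Fin d → ℝ)}
    (h : IsChoquetTD χ μ) (h' : IsChoquetTD χ' μ') :
    (∀ A : Finset (Fin d), A.Nonempty → χ A ≤ χ' A) ↔ UOLE μ μ' := by
  obtain ⟨w, hw, hχ, rfl⟩ := h.exists_isSpectral
  obtain ⟨w', hw', hχ', rfl⟩ := h'.exists_isSpectral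
  have : (∀ A : Finset (Fin d), A.Nonempty → χ A ≤ χ' A) ↔
      ∀ A : Finset (Fin d), A.Nonempty → upSum w A ≤ upSum w' A :=
    forall₂_congr fun A hA => by rw [hχ A hA, hχ' A hA]
  rw [this]
  exact ⟨UOLE_of_upSum_le hw hw', fun h A hA => upSum_le_of_UOLE hw hw' h hA⟩

theorem IsChoquetEC.unique {θ : Finset (Fin d) → ℝ} {μ μ' : Measure (Fin d → ℝ)}
    (h : IsChoquetEC θ μ) (h' : IsChoquetEC θ μ') : μ = μ' := by
  have h1 := (h.le_iff_LOLE h').1 fun _ _ => le_rfl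
  have h2 := (h'.le_iff_LOLE h).1 fun _ _ => le_rfl
  obtain ⟨_, hρ, -⟩ := h
  obtain ⟨_, hρ', -⟩ := h'
  have := hρ.law_prob
  have := hρ'.law_prob
  exact ext_of_lowerOrthant fun a => le_antisymm (h2 a) (h1 a)

theorem IsChoquetTD.unique {χ : Finset (Fin d) → ℝ} {μ μ' : Measure (Fin d → ℝ)}
    (h : IsChoquetTD χ μ) (h' : IsChoquetTD χ μ') : μ = μ' := by
  have h1 := (h.le_iff_UOLE h').1 fun _ _ => le_rfl
  have h2 := (h'.le_iff_UOLE h).1 fun _ _ => le_rfl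
  obtain ⟨_, hρ, -⟩ := h
  obtain ⟨_, hρ', -⟩ := h'
  have := hρ.law_prob
  have := hρ'.law_prob
  exact ext_of_upperOrthant fun a => le_antisymm (h1 a) (h2 a)

end Choquet

end MaxStable

end

theorem lemma4p8 (d : ℕ) :
    -- the laws `Choquet_EC(θ)` and `Choquet_TD(χ)` are well defined
    (∀ θ : Finset (Fin d) → ℝ, MaxStable.IsExtremalCoeff θ →
      ∃! μ : Measure (Fin d → ℝ), MaxStable.IsChoquetEC θ μ) ∧
    (∀ χ : Finset (Fin d) → ℝ, MaxStable.IsTailDepCoeff χ →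
      ∃! μ : Measure (Fin d → ℝ), MaxStable.IsChoquetTD χ μ) ∧
    -- lower orthant order
    (∀ (θ θ' : Finset (Fin d) → ℝ) (μ μ' : Measure (Fin d → ℝ)),
      MaxStable.IsChoquetEC θ μ → MaxStable.IsChoquetEC θ' μ' →
      ((∀ A : Finset (Fin d), A.Nonempty → θ A ≤ θ' A) ↔ MaxStable.LOLE μ μ')) ∧
    -- upper orthant order
    (∀ (χ χ' : Finset (Fin d) → ℝ) (μ μ' : Measure (Fin d → ℝ)),
      MaxStable.IsChoquetTD χ μ → MaxStable.IsChoquetTD χ' μ' →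
      ((∀ A : Finset (Fin d), A.Nonempty → χ A ≤ χ' A) ↔ MaxStable.UOLE μ μ')) := by
  refine ⟨fun θ hθ => ?_, fun χ hχ => ?_, fun θ θ' μ μ' h h' => h.le_iff_LOLE h',
    fun χ χ' μ μ' h h' => h.le_iff_UOLE h'⟩
  · obtain ⟨μ, hμ⟩ := hθ.exists_isChoquetEC
    exact ⟨μ, hμ, fun ν hν => hν.unique hμ⟩
  · obtain ⟨μ, hμ⟩ := hχ.exists_isChoquetTD
    exact ⟨μ, hμ, fun ν hν => hν.unique hμ⟩
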